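/- **Notation.** Fix a universe of sets. For a set $S$ let $S^*$ be the set of words on $S$, $|w|$ the length of $w=(w_0,\dots,w_{|w|-1})$, $(s)$ the one-letter word, and $\curlywedge_S\colon S^{**}\to S^*$ the concatenation of a string of words. For $\varphi\colon S\to T$ let $\varphi^*\colon S^*\to T^*$ apply $\varphi$ letterwise; for $\varphi\colon S\to T^*$ let $\varphi^\sharp\colon S^*\to T^*$ be $\varphi^\sharp(w)=\varphi(w_0)\cdots\varphi(w_{|w|-1})$. For a family $A=(A_j)_{j\in J}$ and $f\colon I\to J$ write $A_f=(A_{f(i)})_{i\in I}$. **Signatures.** A signature $\boldsymbol\Sigma=(S,\Sigma)$ is a set $S$ with a family $\Sigma=(\Sigma_{w,s})_{(w,s)\in S^*\times S}$ of sets. A morphism $(S,\Sigma)\to(T,\Lambda)$ is a pair $(\varphi,d)$ with $\varphi\colon S\to T$ and $d\colon\Sigma\to\Lambda_{\varphi^*\times\varphi}$. These form the category $\mathbf{Sig}$. Let $\coprod\Sigma$ be the $S^*\times S^*$-sorted set whose component at $(w,v)$ is $\Sigma_{w,s}$ if $v=(s)$, and empty if $v$ is not a one-letter word. **Bénabou algebras.**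 A Bénabou algebra for $S$ is an $S^*\times S^*$-sorted set $A$ with elements $\pi^w_i\in A_{w,(w_i)}$ ($i<|w|$), maps $\langle\ \rangle_{u,w}\colon\prod_{i<|w|}A_{u,(w_i)}\to A_{u,w}$ and maps $\circ\colon A_{x,w}\times A_{u,x}\to A_{u,w}$, such that always $\pi^w_i\circ\langle a_0,\dots,a_{|w|-1}\rangle=a_i$; $a\circ\langle\pi^u_0,\dots,\pi^u_{|u|-1}\rangle=a$ and $\langle\pi^w_0\circ a,\dots,\pi^w_{|w|-1}\circ a\rangle=a$ for $a\in A_{u,w}$; $\langle\pi^w_0\rangle=\pi^w_0$ for $w$ non-empty; and $c\circ(b\circ a)=(c\circ b)\circ a$. Let $\mathbf T_{B_S}(\Theta)$ be the free Bénabou algebra on an $S^*\times S^*$-sorted set $\Theta$, with insertion of generators $\eta^{B_S}_\Theta$, and let $\mu^{B_S}$ be the multiplication of the resulting monad on $S^*\times S^*$-sorted sets. For a Bénabou algebra $A$ for $T$ and $\varphi\colon S\to T^*$, the family $A_{\varphi^\sharp\times\varphi^\sharp}$ is a Bénabou algebra for $S$ with structure given by the derivor $b^\varphi$: its $i$-th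 projection for $w$ is the tuple of those $\pi^{\varphi^\sharp(w)}_k$ whose index $k$ lies in the block $\varphi(w_i)$ of $\varphi^\sharp(w)$; its tupling sends $(a_i)_{i<|w|}$ to the tuple of all $\pi^{\varphi(w_i)}_j\circ a_i$, in the order of the blocks; its $\circ$ is that of $A$. **Polyderivors.** Let $\mathbf{BTer}_T(\Lambda)$ be the Bénabou algebra for $T$ with component $\prod_{i<|w|}\mathrm T_\Lambda(\downarrow\! u)_{w_i}$ at $(u,w)$, where $\mathrm T_\Lambda(\downarrow\! u)$ are the $\Lambda$-terms in variables $v_0,\dots,v_{|u|-1}$ of sorts $u_0,\dots,u_{|u|-1}$; its projections are the variables, its tupling is tupling, and its $\circ$ is substitution. It is free on $\coprod\Lambda$, an operation $\sigma$ being identified with the term $\sigma(v_0,\dots,v_{|w|-1})$. A polyderivor $(S,\Sigma)\to(T,\Lambda)$ is a pair $(\varphi,d)$ with $\varphi\colon S\to T^*$ and $d\colon\Sigma\to\mathbf{BTer}_T(\Lambda)_{\varphi^\sharp\times\varphi}$; let $d^\sharp\colon\mathbf{BTer}_S(\Sigma)\to\mathbf{BTer}_T(\Lambda)_{\varphi^\sharp\times\varphi^\sharp}$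 be the homomorphism of Bénabou algebras that extends $d$. With composition $(\psi,e)\circ(\varphi,d)=(\psi^\sharp\circ\varphi,\ e^\sharp_{\varphi^\sharp\times\varphi^\sharp}\circ d)$ and identities $(s\mapsto(s),\ \sigma\mapsto\sigma(v_0,\dots,v_{|w|-1}))$, signatures and polyderivors form the category $\mathbf{Sig}_{\mathfrak{pd}}$. **Proposition.** There is a monad $\mathbb T_{\mathfrak{pd}}=(\mathfrak{pd},\eta^{\mathfrak{pd}},\mu^{\mathfrak{pd}})$ on $\mathbf{Sig}$ given by the following data: 1. $\mathfrak{pd}(S,\Sigma)=(S^*,\mathbf T_{B_S}(\coprod\Sigma)_{\curlywedge_S\times1})$; and $\mathfrak{pd}(\varphi,d)=(\varphi^*,(d^\sharp)_{\curlywedge_S\times1})$, where $d^\sharp\colon\mathbf T_{B_S}(\coprod\Sigma)\to\mathbf T_{B_T}(\coprod\Lambda)_{\varphi^*\times\varphi^*}$ is the homomorphism of Bénabou algebras for $S$ that extends $d$ (the structure on the target being given by $b^{s\mapsto(\varphi(s))}$); 2. $\eta^{\mathfrak{pd}}_{(S,\Sigma)}$ is $s\mapsto(s)$ on sorts and the insertion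 of generators on operations; 3. $\mu^{\mathfrak{pd}}_{(S,\Sigma)}$ is $\curlywedge_S$ on sorts, and on operations it is $\alpha_\Theta$ for $\Theta=\mathbf T_{B_S}(\coprod\Sigma)$ followed by $\mu^{B_S}_{\coprod\Sigma}\colon\mathbf T_{B_S}(\Theta)\to\Theta$. Here, for an $S^*\times S^*$-sorted set $\Theta$, $\alpha_\Theta\colon\mathbf T_{B_{S^*}}(\coprod\Theta_{\curlywedge_S\times1})\to\mathbf T_{B_S}(\Theta)_{\curlywedge_S\times\curlywedge_S}$ is the homomorphism of Bénabou algebras for $S^*$ that extends $\eta^{B_S}_\Theta$, the structure on its target being given by the derivor $b^{\curlywedge_S}$. The categories $\mathbf{Sig}_{\mathfrak{pd}}$ and $\mathbf{Kl}(\mathbb T_{\mathfrak{pd}})$ are isomorphic; an isomorphism is the identity on objects and sends a polyderivor $(\varphi,d)\colon(S,\Sigma)\to(T,\Lambda)$ to the Kleisli morphism $(\varphi,\kappa\circ d)\colon(S,\Sigma)\to\mathfrak{pd}(T,\Lambda)$, with $\kappa\colon\mathbf{BTer}_T(\Lambda)\to\mathbf T_{B_T}(\coprod\Lambda)$ the canonical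 homomorphism. -/

import Mathlib

open CategoryTheory

universe u v

namespace ManySorted

/-- Transport in a family indexed by two indices. -/
def move {I J : Type*} (F : I → J → Type v) {i i' : I} {j j' : J} (hi : i = i') (hj : j = j')
    (a : F i j) : F i' j' :=
  hj ▸ hi ▸ a

@[simp]
theorem move_self {I J : Type*} (F : I → J → Type v) {i : I} {j : J} (hi : i = i) (hj : j = j)
    (a : F i j) : move F hi hj a = a := rfl

theorem move_move {I J : Type*} (F : I → J → Type v) {i i' i'' : I} {j j' j'' : J}
    (hi : i = i') (hj : j = j') (hi' : i' = i'') (hj' : j' = j'') (a : F i j) :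
    move F hi' hj' (move F hi hj a) = move F (hi.trans hi') (hj.trans hj') a := by
  subst hi hj hi' hj'
  rfl

theorem move_heq {I J : Type*} (F : I → J → Type v) {i i' : I} {j j' : J} (hi : i = i')
    (hj : j = j') (a : F i j) : move F hi hj a ≍ a := by
  subst hi hj
  rfl

/-! ### The category of many-sorted signatures -/

/-- A many-sorted signature: a set of sorts `S` and an `S* × S`-sorted set of formal operations.
Words on `S` are lists. -/
structure Sig : Type (u + 1) where
  sorts : Type u
  ops : List sorts → sorts → Type u

/-- A signature morphism `(φ, d)`, with `d : Σ ⟶ Λ_{φ* × φ}`. -/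
structure SigHom (A B : Sig.{u}) : Type u where
  onSorts : A.sorts → B.sorts
  onOps : ∀ {w : List A.sorts} {s : A.sorts}, A.ops w s → B.ops (w.map onSorts) (onSorts s)

theorem SigHom.ext' {A B : Sig.{u}} {f g : SigHom A B} (h : ∀ s, f.onSorts s = g.onSorts s)
    (h' : ∀ {w : List A.sorts} {s : A.sorts} (σ : A.ops w s),
      move B.ops (List.map_congr_left fun s _ => h s) (h s) (f.onOps σ) = g.onOps σ) :
    f = g := by
  obtain ⟨f₁, f₂⟩ := f
  obtain ⟨g₁, g₂⟩ := g
  obtain rfl : f₁ = g₁ := funext h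
  congr 1
  funext w s σ
  exact h' σ

theorem SigHom.onOps_move {A B : Sig.{u}} (f : SigHom A B) {w w' : List A.sorts} {s s' : A.sorts}
    (hw : w = w') (hs : s = s') (σ : A.ops w s) :
    f.onOps (move A.ops hw hs σ) =
      move B.ops (congrArg _ hw) (congrArg _ hs) (f.onOps σ) := by
  subst hw hs
  rfl

/-- The category **Sig**. -/
instance : Category.{u} Sig.{u} where
  Hom := SigHom
  id A := ⟨fun s => s, fun σ => move A.ops (List.map_id _).symm rfl σ⟩
  comp {_ _ C} f g :=
    ⟨fun s => g.onSorts (f.onSorts s), fun σ => move C.ops List.map_map rfl (g.onOps (f.onOps σ))⟩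
  id_comp f := SigHom.ext' (fun _ => rfl) (by
    intro w s σ
    simp [SigHom.onOps_move, move_move])
  comp_id f := SigHom.ext' (fun _ => rfl) (by
    intro w s σ
    simp [move_move])
  assoc f g h := SigHom.ext' (fun _ => rfl) (by
    intro w s σ
    simp [SigHom.onOps_move, move_move])

/-! ### Bénabou algebras -/

/-- A family indexed by the one-letter word `(s)`, given by its only member. -/
def single {S : Type u} {F : S → Type v} {s : S} (a : F s) (i : Fin [s].length) : F ([s].get i) :=
  (show s = [s].get i by simp) ▸ a

/-- A Bénabou algebra for `S`: an `S* × S*`-sorted set with projections `π_i^w ∈ A_{w,(w_i)}`,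
finite tuplings `⟨ ⟩_{x,w} : ∏_i A_{x,(w_i)} → A_{x,w}` and substitutions
`∘_{x,y,w} : A_{x,y} × A_{y,w} → A_{x,w}` (so that `comp P Q` is `Q ∘ P`),
satisfying the five defining equations. -/
structure BenAlg (S : Type u) : Type (u + 1) where
  carrier : List S → List S → Type u
  proj : ∀ (w : List S) (i : Fin w.length), carrier w [w.get i]
  tup : ∀ {x w : List S}, (∀ i : Fin w.length, carrier x [w.get i]) → carrier x w
  comp : ∀ {x y w : List S}, carrier x y → carrier y w → carrier x w
  proj_tup : ∀ {x w : List S} (f : ∀ i : Fin w.length, carrier x [w.get i]) (i : Fin w.length),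
    comp (tup f) (proj w i) = f i
  comp_tup_proj : ∀ {x w : List S} (a : carrier x w), comp (tup (proj x)) a = a
  tup_proj : ∀ {x w : List S} (a : carrier x w), tup (fun i => comp a (proj w i)) = a
  tup_single : ∀ (s : S) (w : List S),
    tup (w := [s]) (single (F := fun t => carrier (s :: w) [t]) (proj (s :: w) 0)) =
      proj (s :: w) 0
  assoc : ∀ {x y z w : List S} (c : carrier x y) (b : carrier y z) (a : carrier z w),
    comp (comp c b) a = comp c (comp b a)

/-- A homomorphism of Bénabou algebras. -/
structure BenHom {S : Type u} (A B : BenAlg S) : Type u where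
  map : ∀ {x w : List S}, A.carrier x w → B.carrier x w
  map_proj : ∀ (w : List S) (i : Fin w.length), map (A.proj w i) = B.proj w i
  map_tup : ∀ {x w : List S} (f : ∀ i : Fin w.length, A.carrier x [w.get i]),
    map (A.tup f) = B.tup fun i => map (f i)
  map_comp : ∀ {x y w : List S} (a : A.carrier x y) (b : A.carrier y w),
    map (A.comp a b) = B.comp (map a) (map b)

/-- The `S`-sorted set of variables `↓w`: `(↓w)_s = {v_i^s | w_i = s}`. -/
structure Var {S : Type u} (w : List S) (s : S) : Type where
  idx : Fin w.length
  get_idx : w.get idx = s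

theorem Var.ext {S : Type u} {w : List S} {s : S} {x y : Var w s}
    (h : (x.1 : ℕ) = (y.1 : ℕ)) : x = y := by
  obtain ⟨x, hx⟩ := x
  obtain ⟨y, hy⟩ := y
  obtain rfl : x = y := Fin.ext h
  rfl

namespace BenAlg

variable {S : Type u} (A : BenAlg S)

/-- The projection `π_i^w`, for `v_i^s ∈ (↓w)_s`, as an element of `A_{w,(s)}`. -/
def prj {w : List S} {s : S} (x : Var w s) : A.carrier w [s] :=
  move A.carrier rfl (congrArg (fun t => [t]) x.2) (A.proj w x.1)

variable {A}

/-- The component of `a ∈ A_{x,w}` at a variable of `↓w`. -/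
def coord {x w : List S} (a : A.carrier x w) {s : S} (i : Var w s) : A.carrier x [s] :=
  A.comp a (A.prj i)

theorem coord_tup {x w : List S} (f : ∀ i : Fin w.length, A.carrier x [w.get i]) {s : S}
    (i : Var w s) :
    coord (A.tup f) i = move A.carrier rfl (congrArg (fun t => [t]) i.2) (f i.1) := by
  obtain ⟨i, rfl⟩ := i
  exact A.proj_tup f i

theorem coord_tup' {x w : List S} (f : ∀ i : Fin w.length, A.carrier x [w.get i])
    (i : Fin w.length) : coord (A.tup f) ⟨i, rfl⟩ = f i :=
  A.proj_tup f i

theorem coord_ext {x w : List S} {a b : A.carrier x w}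
    (h : ∀ {s : S} (i : Var w s), coord a i = coord b i) : a = b := by
  rw [← A.tup_proj a, ← A.tup_proj b]
  exact congrArg _ (funext fun i => h ⟨i, rfl⟩)

theorem coord_comp {x y w : List S} (a : A.carrier x y) (b : A.carrier y w) {s : S} (i : Var w s) :
    coord (A.comp a b) i = A.comp a (coord b i) :=
  A.assoc _ _ _

theorem coord_move {x x' w w' : List S} (hx : x = x') (hw : w = w') (a : A.carrier x w) {s : S}
    (i : Var w' s) (j : Var w s) (hij : (i.1 : ℕ) = j.1) :
    coord (move A.carrier hx hw a) i = move A.carrier hx rfl (coord a j) := by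
  subst hx hw
  rw [Var.ext hij]
  rfl

theorem comp_move {x x' y y' w w' : List S} (hx : x = x') (hy : y = y') (hw : w = w')
    (a : A.carrier x y) (b : A.carrier y w) :
    A.comp (move A.carrier hx hy a) (move A.carrier hy hw b) =
      move A.carrier hx hw (A.comp a b) := by
  subst hx hy hw
  rfl

theorem prj_move {w w' : List S} (hw : w = w') {s : S} (i : Var w s) (j : Var w' s)
    (hij : (i.1 : ℕ) = j.1) : move A.carrier hw rfl (A.prj i) = A.prj j := by
  subst hw
  rw [Var.ext hij]
  rfl

/-- The identity on the word `w`. -/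
def one (A : BenAlg S) (w : List S) : A.carrier w w := A.tup (A.proj w)

theorem one_comp {x w : List S} (a : A.carrier x w) : A.comp (A.one x) a = a :=
  A.comp_tup_proj a

theorem comp_one {x w : List S} (a : A.carrier x w) : A.comp a (A.one w) = a := by
  apply coord_ext
  intro s i
  rw [coord_comp, one, coord_tup]
  rfl

theorem proj_zero (s : S) : A.proj [s] 0 = A.one [s] := by
  rw [one, ← A.tup_single s []]
  congr 1
  funext i
  obtain rfl : i = 0 := Subsingleton.elim (α := Fin 1) _ _
  rfl

theorem prj_single {s : S} (i : Var [s] s) : A.prj i = A.one [s] := by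
  rw [← proj_zero]
  obtain ⟨i, hi⟩ := i
  obtain rfl : i = 0 := Subsingleton.elim (α := Fin 1) _ _
  rfl

theorem coord_single {x : List S} {s : S} (a : A.carrier x [s]) (i : Var [s] s) : coord a i = a := by
  rw [coord, prj_single, comp_one]

/-- One-letter tuples are trivial. -/
theorem tup_one {x : List S} {s : S} (f : ∀ i : Fin [s].length, A.carrier x [[s].get i]) :
    A.tup (w := [s]) f = f 0 := by
  rw [← coord_single (A.tup (w := [s]) f) ⟨0, rfl⟩]
  exact coord_tup' (w := [s]) f 0

end BenAlg

namespace BenHom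

variable {S : Type u} {A B C : BenAlg S}

theorem map_move (h : BenHom A B) {x x' w w' : List S} (hx : x = x') (hw : w = w')
    (a : A.carrier x w) :
    h.map (move A.carrier hx hw a) = move B.carrier hx hw (h.map a) := by
  subst hx hw
  rfl

theorem map_prj (h : BenHom A B) {w : List S} {s : S} (i : Var w s) :
    h.map (A.prj i) = B.prj i := by
  rw [BenAlg.prj, map_move, map_proj]
  rfl

/-- A composition-preserving map that preserves projections preserves tuplings. -/
def ofComp (map : ∀ {x w : List S}, A.carrier x w → B.carrier x w)
    (map_proj : ∀ (w : List S) (i : Fin w.length), map (A.proj w i) = B.proj w i)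
    (map_comp : ∀ {x y w : List S} (a : A.carrier x y) (b : A.carrier y w),
      map (A.comp a b) = B.comp (map a) (map b)) : BenHom A B where
  map := map
  map_proj := map_proj
  map_comp := map_comp
  map_tup f := by
    apply BenAlg.coord_ext
    rintro s ⟨i, rfl⟩
    rw [BenAlg.coord_tup']
    change B.comp _ (B.proj _ i) = _
    rw [← map_proj, ← map_comp, A.proj_tup]

/-- Composition of homomorphisms. -/
def trans (h : BenHom A B) (k : BenHom B C) : BenHom A C where
  map a := k.map (h.map a)
  map_proj w i := by rw [h.map_proj, k.map_proj]
  map_tup f := by rw [h.map_tup, k.map_tup]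
  map_comp a b := by rw [h.map_comp, k.map_comp]

end BenHom

/-! ### Change of sorts for Bénabou algebras -/

section Pull

variable {S T U : Type u}

/-- The position in `φ♯(w) = φ(w_0) ⋯ φ(w_{n-1})` at which the block `φ(w_i)` starts, i.e. the sum
of the lengths of the preceding blocks. The extension `φ♯ : S* → T*` of `φ : S → T*` is
`fun w => w.flatMap φ`. -/
def off (φ : S → List T) (w : List S) (i : ℕ) : ℕ := ((w.take i).flatMap φ).length

theorem off_zero (φ : S → List T) (w : List S) : off φ w 0 = 0 := by simp [off]

theorem off_cons_succ (φ : S → List T) (s : S) (w : List S) (i : ℕ) :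
    off φ (s :: w) (i + 1) = (φ s).length + off φ w i := by
  simp [off]

theorem off_block (φ : S → List T) (w : List S) (i : Fin w.length) :
    ∀ j (hj : j < ([w.get i].flatMap φ).length),
      ∃ h : off φ w i + j < (w.flatMap φ).length,
        (w.flatMap φ).get ⟨off φ w i + j, h⟩ = ([w.get i].flatMap φ).get ⟨j, hj⟩ := by
  induction w with
  | nil => exact i.elim0
  | cons s w ih =>
    intro j hj
    obtain ⟨i, hi⟩ := i
    cases i with
    | zero =>
      have hj' : j < (φ s).length := by simpa using hj
      refine ⟨by simp [off]; omega, ?_⟩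
      simp only [off, List.get_eq_getElem, List.flatMap_cons]
      simp [hj']
    | succ i =>
      have hi' : i < w.length := by simpa using hi
      obtain ⟨h, e⟩ := ih ⟨i, hi'⟩ j hj
      refine ⟨by simp only [off_cons_succ, List.flatMap_cons, List.length_append]
                 simp only at h; omega, ?_⟩
      simp only [List.get_eq_getElem] at e ⊢
      simp only [off_cons_succ, List.flatMap_cons]
      rw [List.getElem_append_right (by omega)]
      have e2 : (φ s).length + off φ w i + j - (φ s).length = off φ w i + j := by omega
      simp only [e2, e]
      rfl

theorem exists_block (φ : S → List T) (w : List S) (k : ℕ) (hk : k < (w.flatMap φ).length) :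
    ∃ i : Fin w.length, ∃ j : Fin ([w.get i].flatMap φ).length, off φ w i + j = k := by
  induction w generalizing k with
  | nil => simp at hk
  | cons s w ih =>
    by_cases h : k < (φ s).length
    · exact ⟨⟨0, by simp⟩, ⟨k, by simpa using h⟩, by simp [off_zero]⟩
    · have hk' : k - (φ s).length < (w.flatMap φ).length := by
        rw [List.flatMap_cons, List.length_append] at hk; omega
      obtain ⟨i, j, e⟩ := ih _ hk'
      refine ⟨⟨i + 1, by simp⟩, ⟨j, j.2⟩, ?_⟩
      simp only [off_cons_succ]
      omega

theorem block_unique (φ : S → List T) (w : List S) (i i' : Fin w.length)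
    (j : Fin ([w.get i].flatMap φ).length) (j' : Fin ([w.get i'].flatMap φ).length)
    (h : off φ w i + j = off φ w i' + j') : i = i' ∧ (j : ℕ) = j' := by
  induction w with
  | nil => exact i.elim0
  | cons s w ih =>
    obtain ⟨i, hi⟩ := i
    obtain ⟨i', hi'⟩ := i'
    obtain ⟨j, hj⟩ := j
    obtain ⟨j', hj'⟩ := j'
    cases i with
    | zero =>
      cases i' with
      | zero => simpa [off_zero] using h
      | succ i' =>
        simp only [off_zero, off_cons_succ] at h
        simp at hj
        omega
    | succ i =>
      cases i' with
      | zero =>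
        simp only [off_zero, off_cons_succ] at h
        simp at hj'
        omega
      | succ i' =>
        simp only [off_cons_succ] at h
        have := ih ⟨i, by simpa using hi⟩ ⟨i', by simpa using hi'⟩ ⟨j, hj⟩ ⟨j', hj'⟩ (by
          simp only; omega)
        simpa using this

/-- The `j`-th variable of the `i`-th block of `φ♯(w)`. -/
def inBlock (φ : S → List T) (w : List S) (i : Fin w.length) {t : T}
    (j : Var ([w.get i].flatMap φ) t) : Var (w.flatMap φ) t :=
  ⟨⟨off φ w i + j.1, (off_block φ w i j.1 j.1.2).1⟩, (off_block φ w i j.1 j.1.2).2.trans j.2⟩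

theorem exists_inBlock (φ : S → List T) (w : List S) {t : T} (k : Var (w.flatMap φ) t) :
    ∃ p : Σ i : Fin w.length, Var ([w.get i].flatMap φ) t, inBlock φ w p.1 p.2 = k := by
  obtain ⟨i, j, h⟩ := exists_block φ w k.1 k.1.2
  refine ⟨⟨i, j, ?_⟩, Var.ext h⟩
  rw [← (off_block φ w i j j.2).2, ← k.2]
  congr 1
  exact Fin.ext h

/-- The block of `φ♯(w)` that a variable belongs to, and its place in that block. -/
noncomputable def blockOf (φ : S → List T) (w : List S) {t : T} (k : Var (w.flatMap φ) t) :
    Σ i : Fin w.length, Var ([w.get i].flatMap φ) t :=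
  (exists_inBlock φ w k).choose

theorem inBlock_blockOf (φ : S → List T) (w : List S) {t : T} (k : Var (w.flatMap φ) t) :
    inBlock φ w (blockOf φ w k).1 (blockOf φ w k).2 = k :=
  (exists_inBlock φ w k).choose_spec

theorem blockOf_inBlock (φ : S → List T) (w : List S) (i : Fin w.length) {t : T}
    (j : Var ([w.get i].flatMap φ) t) : blockOf φ w (inBlock φ w i j) = ⟨i, j⟩ := by
  have h := inBlock_blockOf φ w (inBlock φ w i j)
  generalize blockOf φ w (inBlock φ w i j) = p at h ⊢
  obtain ⟨i', j'⟩ := p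
  have h' := block_unique φ w i' i j'.1 j.1 (congrArg (fun k => (k.1 : ℕ)) h)
  obtain ⟨rfl, h'⟩ := h'
  rw [Var.ext h']

open BenAlg

/-- The projection `b^φ(π_i^w) = ⟨π_p^{φ♯(w)}, …, π_q^{φ♯(w)}⟩`, where `p, …, q` are the positions
of the block `φ(w_i)` in `φ♯(w)`. -/
def pullProj (A : BenAlg T) (φ : S → List T) (w : List S) (i : Fin w.length) :
    A.carrier (w.flatMap φ) ([w.get i].flatMap φ) :=
  A.tup fun j => A.prj (inBlock φ w i ⟨j, rfl⟩)

/-- The tupling `b^φ(⟨ ⟩_{x,w})`: the family `(f_i)_i` goes to the tuple of all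
`π_j^{φ(w_i)} ∘ f_i`, in the order of the blocks. -/
noncomputable def pullTup (A : BenAlg T) (φ : S → List T) {x w : List S}
    (f : ∀ i : Fin w.length, A.carrier (x.flatMap φ) ([w.get i].flatMap φ)) :
    A.carrier (x.flatMap φ) (w.flatMap φ) :=
  A.tup fun k => A.comp (f (blockOf φ w ⟨k, rfl⟩).1) (A.prj (blockOf φ w ⟨k, rfl⟩).2)

theorem coord_pullProj (A : BenAlg T) (φ : S → List T) (w : List S) (i : Fin w.length) {t : T}
    (j : Var ([w.get i].flatMap φ) t) :
    coord (pullProj A φ w i) j = A.prj (inBlock φ w i j) := by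
  obtain ⟨j, rfl⟩ := j
  exact coord_tup' _ _

theorem coord_pullTup (A : BenAlg T) (φ : S → List T) {x w : List S}
    (f : ∀ i : Fin w.length, A.carrier (x.flatMap φ) ([w.get i].flatMap φ)) (i : Fin w.length)
    {t : T} (j : Var ([w.get i].flatMap φ) t) :
    coord (pullTup A φ f) (inBlock φ w i j) = coord (f i) j := by
  have key : ∀ {t : T} (k : Var (w.flatMap φ) t),
      coord (pullTup A φ f) k = coord (f (blockOf φ w k).1) (blockOf φ w k).2 := by
    rintro t ⟨k, rfl⟩
    exact coord_tup' _ _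
  rw [key, blockOf_inBlock]

theorem pull_ext {A : BenAlg T} {φ : S → List T} {x : List T} {w : List S}
    {a b : A.carrier x (w.flatMap φ)}
    (h : ∀ (i : Fin w.length) {t : T} (j : Var ([w.get i].flatMap φ) t),
      coord a (inBlock φ w i j) = coord b (inBlock φ w i j)) : a = b := by
  apply coord_ext
  intro t k
  rw [← inBlock_blockOf φ w k]
  exact h _ _

/-- For `φ : S → T*` and a Bénabou algebra `A` for `T`, the Bénabou algebra `A_{φ♯ × φ♯}` for `S`
whose operations are the realizations in `A` of the terms assigned by the derivor `b^φ`. -/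
noncomputable def pull (A : BenAlg T) (φ : S → List T) : BenAlg S where
  carrier x w := A.carrier (x.flatMap φ) (w.flatMap φ)
  proj w i := pullProj A φ w i
  tup f := pullTup A φ f
  comp a b := A.comp a b
  proj_tup {x w} f i := by
    apply coord_ext
    intro t j
    rw [coord_comp, coord_pullProj]
    exact coord_pullTup A φ f i j
  comp_tup_proj {x w} a := by
    have : pullTup A φ (pullProj A φ x) = A.one _ := by
      apply pull_ext
      intro i t j
      rw [coord_pullTup, coord_pullProj]
      exact (one_comp _).symm
    rw [this, one_comp]
  tup_proj {x w} a := by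
    apply pull_ext
    intro i t j
    rw [coord_pullTup, coord_comp, coord_pullProj]
    rfl
  tup_single s w := by
    refine pull_ext (w := [s]) ?_
    intro i t j
    rw [coord_pullTup]
    obtain rfl : i = 0 := Subsingleton.elim (α := Fin 1) _ _
    have : inBlock φ [s] 0 j = j := Var.ext (by simp [inBlock, off])
    rw [this]
    rfl
  assoc c b a := A.assoc c b a

/-- Change of sorts is functorial. -/
noncomputable def pullMap {A B : BenAlg T} (h : BenHom A B) (φ : S → List T) :
    BenHom (pull A φ) (pull B φ) :=
  BenHom.ofComp (fun a => h.map a)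
    (fun w i => by
      refine (h.map_tup _).trans ?_
      simp only [BenHom.map_prj]
      rfl)
    (fun a b => h.map_comp _ _)

theorem flatMap_singleton' (w : List S) : w.flatMap (fun s => [s]) = w := by
  induction w <;> simp_all

/-- Change of sorts along `s ↦ (s)` changes nothing. -/
noncomputable def pullUnit (A : BenAlg S) : BenHom A (pull A fun s => [s]) :=
  BenHom.ofComp
    (fun a => move A.carrier (flatMap_singleton' _).symm (flatMap_singleton' _).symm a)
    (fun w i => by
      change _ = pullProj A _ w i
      apply coord_ext
      intro t j
      have hj : (j.1 : ℕ) = 0 := by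
        have : (j.1 : ℕ) < 1 := lt_of_lt_of_eq j.1.2 (by simp)
        omega
      obtain rfl : w.get i = t := by
        rw [← j.2]
        simp
      rw [coord_pullProj]
      refine (coord_move _ _ (A.proj w i) j (⟨0, rfl⟩ : Var [w.get i] (w.get i)) hj).trans ?_
      rw [coord_single]
      refine prj_move (i := ⟨i, rfl⟩) _ _ ?_
      simp only [inBlock, hj, off, flatMap_singleton']
      simp)
    (fun a b => (comp_move _ _ _ _ _).symm)

theorem off_comp (φ : S → List T) (ψ : T → List U) (w : List S) (i : Fin w.length) (j : ℕ)
    (hj : j ≤ ([w.get i].flatMap φ).length) :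
    off ψ (w.flatMap φ) (off φ w i + j) =
      off (fun s => (φ s).flatMap ψ) w i + off ψ ([w.get i].flatMap φ) j := by
  have : (w.flatMap φ).take (off φ w i + j) =
      (w.take i).flatMap φ ++ ([w.get i].flatMap φ).take j := by
    have h : w = w.take i ++ ([w.get i] ++ w.drop (i + 1)) := by simp
    have h' : w.flatMap φ = (w.take i ++ ([w.get i] ++ w.drop (i + 1))).flatMap φ :=
      congrArg (List.flatMap φ) h
    rw [h', List.flatMap_append, off, List.take_length_add_append, List.flatMap_append,
      List.take_append_of_le_length hj]
  rw [off, this, List.flatMap_append, List.length_append, List.flatMap_assoc]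
  rfl

/-- Successive changes of sorts compose. -/
noncomputable def pullAssoc (A : BenAlg U) (φ : S → List T) (ψ : T → List U) :
    BenHom (pull (pull A ψ) φ) (pull A fun s => (φ s).flatMap ψ) :=
  BenHom.ofComp
    (fun a => move A.carrier List.flatMap_assoc List.flatMap_assoc a)
    (fun w i => by
      change move _ _ _ (pullTup A ψ (w := [w.get i].flatMap φ) fun j =>
        (pull A ψ).prj (inBlock φ w i ⟨j, rfl⟩)) = pullProj A _ w i
      apply coord_ext
      intro t K
      rw [coord_pullProj]
      have hpi : ∀ {w : List T} {t : T} (x : Var w t) {s : U} (j : Var ([t].flatMap ψ) s),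
          ∃ y : Var (w.flatMap ψ) s, (y.1 : ℕ) = off ψ w x.1 + j.1 ∧
            coord (A := A) ((pull A ψ).prj x) j = A.prj y := by
        rintro w t ⟨x, rfl⟩ s j
        exact ⟨inBlock ψ w x j, rfl, coord_pullProj A ψ w x j⟩
      have e : [w.get i].flatMap (fun s => (φ s).flatMap ψ) = ([w.get i].flatMap φ).flatMap ψ :=
        List.flatMap_assoc.symm
      obtain ⟨K', hK⟩ : ∃ K' : Var (([w.get i].flatMap φ).flatMap ψ) t,
          (K.1 : ℕ) = K'.1 := by
        rw [← e]; exact ⟨K, rfl⟩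
      rw [coord_move _ _ _ _ K' hK]
      obtain ⟨⟨j, l⟩, hjl⟩ := exists_inBlock ψ _ K'
      subst hjl
      refine (congrArg _ (coord_pullTup A ψ _ j l)).trans ?_
      have hlt : off ψ (w.flatMap φ) (off φ w i + j) + l.1 =
          off (fun s => (φ s).flatMap ψ) w i + K.1 := by
        rw [off_comp φ ψ w i j j.2.le, hK]
        simp only [inBlock]
        omega
      obtain ⟨y, hy, hy'⟩ := hpi (inBlock φ w i ⟨j, rfl⟩) l
      refine (congrArg _ hy').trans ?_
      exact prj_move _ _ _ (hy.trans hlt))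
    (fun a b => (comp_move _ _ _ _ _).symm)

end Pull

/-! ### Terms and the Bénabou algebra of terms -/

/-- The terms for the signature `Λ` on the sorted set of variables `X`, i.e. `T_Λ(X)`. -/
inductive Term (L : Sig.{u}) (X : L.sorts → Type) : L.sorts → Type u
  | var {s : L.sorts} (x : X s) : Term L X s
  | op {w : List L.sorts} {s : L.sorts} (σ : L.ops w s)
      (ts : ∀ i : Fin w.length, Term L X (w.get i)) : Term L X s

/-- Substitution of terms for variables: the homomorphic extension of `P`. -/
def Term.subst {L : Sig.{u}} {X Y : L.sorts → Type} (P : ∀ s : L.sorts, X s → Term L Y s) :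
    ∀ {s : L.sorts}, Term L X s → Term L Y s
  | _, .var x => P _ x
  | _, .op σ ts => .op σ fun i => (ts i).subst P

theorem Term.subst_var {L : Sig.{u}} {X : L.sorts → Type} {s : L.sorts} (t : Term L X s) :
    t.subst (fun _ x => .var x) = t := by
  induction t with
  | var x => rfl
  | op σ ts ih => exact congrArg _ (funext ih)

theorem Term.subst_subst {L : Sig.{u}} {X Y Z : L.sorts → Type}
    (P : ∀ s : L.sorts, X s → Term L Y s) (Q : ∀ s : L.sorts, Y s → Term L Z s)
    {s : L.sorts} (t : Term L X s) :
    (t.subst P).subst Q = t.subst fun s x => (P s x).subst Q := by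
  induction t with
  | var x => rfl
  | op σ ts ih => exact congrArg _ (funext ih)

/-- A family of terms `P ∈ ∏_i T_Λ(↓x)_{w_i}` as a sorted mapping `↓w → T_Λ(↓x)`. -/
def asMap {L : Sig.{u}} {X : L.sorts → Type} {w : List L.sorts}
    (P : ∀ i : Fin w.length, Term L X (w.get i)) (s : L.sorts) (i : Var w s) : Term L X s :=
  i.2 ▸ P i.1

/-- The Bénabou algebra `BTer_T(Λ)` for `(T, Λ)`: its underlying sorted set is
`T_Λ(↓x)_w = ∏_i T_Λ(↓x)_{w_i}` at `(x, w)`, its projections are the variables, its tuplings are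
tuplings, and its substitutions are substitutions of terms. -/
def BTer (L : Sig.{u}) : BenAlg L.sorts where
  carrier x w := ∀ i : Fin w.length, Term L (Var x) (w.get i)
  proj w i := fun j => .var ⟨i, by simp⟩
  tup f := fun i => f i ⟨0, by simp⟩
  comp P Q := fun i => (Q i).subst (asMap P)
  proj_tup {x w} f i := by
    funext j
    obtain rfl : j = ⟨0, by simp⟩ := Subsingleton.elim (α := Fin 1) _ _
    rfl
  comp_tup_proj a := by
    funext i
    refine Eq.trans ?_ (a i).subst_var
    congr 1
    funext s y
    obtain ⟨y, rfl⟩ := y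
    rfl
  tup_proj a := rfl
  tup_single s w := by
    funext j
    obtain rfl : j = ⟨0, by simp⟩ := Subsingleton.elim (α := Fin 1) _ _
    rfl
  assoc c b a := by
    funext i
    refine Eq.trans ?_ ((a i).subst_subst (asMap b) (asMap c)).symm
    congr 1
    funext s y
    obtain ⟨y, rfl⟩ := y
    rfl

/-- A single term as a one-letter family. -/
def BTer.ofTerm {L : Sig.{u}} {x : List L.sorts} {s : L.sorts} (t : Term L (Var x) s) :
    (BTer L).carrier x [s] :=
  single (F := fun t => Term L (Var x) t) t

/-- The insertion of generators: `σ : w ⟶ s` is sent to the term `σ(v_0, …, v_{n-1})`. -/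
def BTer.gen {L : Sig.{u}} {w : List L.sorts} {s : L.sorts} (σ : L.ops w s) :
    (BTer L).carrier w [s] :=
  BTer.ofTerm (Term.op σ fun i => .var ⟨i, rfl⟩)

section Lift

open BenAlg

variable {L : Sig.{u}} (A : BenAlg L.sorts)
  (f : ∀ (w : List L.sorts) (s : L.sorts), L.ops w s → A.carrier w [s])

/-- The value in a Bénabou algebra of a term, for an interpretation `f` of the operations. -/
def liftTerm {w : List L.sorts} : ∀ {s : L.sorts}, Term L (Var w) s → A.carrier w [s]
  | _, .var x => A.prj x
  | _, .op σ ts => A.comp (A.tup fun i => liftTerm (ts i)) (f _ _ σ)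

theorem liftTerm_subst {x w : List L.sorts}
    (P : ∀ i : Fin w.length, Term L (Var x) (w.get i)) {s : L.sorts} (t : Term L (Var w) s) :
    liftTerm A f (t.subst (asMap P)) =
      A.comp (A.tup fun i => liftTerm A f (P i)) (liftTerm A f t) := by
  induction t with
  | var y =>
    obtain ⟨y, rfl⟩ := y
    exact (A.proj_tup (fun i => liftTerm A f (P i)) y).symm
  | op σ ts ih =>
    simp only [Term.subst, liftTerm, ih]
    rw [← A.assoc]
    congr 1
    apply coord_ext
    rintro t ⟨i, rfl⟩
    rw [coord_tup', coord_comp, coord_tup']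

/-- The homomorphism `f♯` from `BTer_T(Λ)` to the Bénabou algebra `A` that extends `f`. -/
def BTer.lift : BenHom (BTer L) A where
  map P := A.tup fun i => liftTerm A f (P i)
  map_proj w i := (tup_one _).trans rfl
  map_tup g := congrArg A.tup (funext fun i =>
    (tup_one fun j => liftTerm A f (g i j)).symm)
  map_comp a b := by
    apply coord_ext
    rintro t ⟨i, rfl⟩
    rw [coord_tup', coord_comp, coord_tup']
    exact liftTerm_subst A f a (b i)

theorem BTer.lift_gen {w : List L.sorts} {s : L.sorts} (σ : L.ops w s) :
    (BTer.lift A f).map (BTer.gen σ) = f w s σ := by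
  refine (tup_one _).trans ?_
  change A.comp (A.tup (A.proj w)) (f w s σ) = f w s σ
  exact A.comp_tup_proj _

variable {A}

/-- Homomorphisms on `BTer_T(Λ)` are determined by their values on the operations. -/
theorem BTer.hom_ext {h k : BenHom (BTer L) A}
    (e : ∀ {w : List L.sorts} {s : L.sorts} (σ : L.ops w s),
      h.map (BTer.gen σ) = k.map (BTer.gen σ))
    {x w : List L.sorts} (P : (BTer L).carrier x w) : h.map P = k.map P := by
  have tup : ∀ {w : List L.sorts} (P : ∀ i : Fin w.length, Term L (Var x) (w.get i)),
      (∀ i, h.map (BTer.ofTerm (P i)) = k.map (BTer.ofTerm (P i))) →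
      h.map ((BTer L).tup fun i => BTer.ofTerm (P i)) =
        k.map ((BTer L).tup fun i => BTer.ofTerm (P i)) := by
    intro w P hP
    rw [h.map_tup, k.map_tup]
    exact congrArg A.tup (funext hP)
  have key : ∀ {s : L.sorts} (t : Term L (Var x) s),
      h.map (BTer.ofTerm t) = k.map (BTer.ofTerm t) := by
    intro s t
    induction t with
    | var y =>
      obtain ⟨y, rfl⟩ := y
      have : BTer.ofTerm (Term.var (⟨y, rfl⟩ : Var x (x.get y))) = (BTer L).proj x y := by
        funext j
        obtain rfl : j = ⟨0, by simp⟩ := Subsingleton.elim (α := Fin 1) _ _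
        rfl
      rw [this, h.map_proj, k.map_proj]
    | @op v s σ ts ih =>
      have : BTer.ofTerm (Term.op σ ts) =
          (BTer L).comp ((BTer L).tup fun i => BTer.ofTerm (ts i)) (BTer.gen σ) := by
        funext j
        obtain rfl : j = ⟨0, by simp⟩ := Subsingleton.elim (α := Fin 1) _ _
        rfl
      rw [this, h.map_comp, k.map_comp, e, tup ts ih]
  exact tup P fun i => key (P i)

end Lift

/-! ### The category of signatures and polyderivors -/

/-- The objects of the category of signatures and polyderivors: the signatures. -/
structure SigPd : Type (u + 1) where
  sig : Sig.{u}

/-- A polyderivor `(φ, d)` from `Σ` to `Λ`: a mapping `φ : S → T*` and an `S* × S`-sorted mapping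
`d : Σ ⟶ BTer_T(Λ)_{φ♯ × φ}`. -/
structure Polyderivor (A B : Sig.{u}) : Type u where
  onSorts : A.sorts → List B.sorts
  onOps : ∀ {w : List A.sorts} {s : A.sorts},
    A.ops w s → (BTer B).carrier (w.flatMap onSorts) (onSorts s)

namespace Polyderivor

variable {A B C D : Sig.{u}}

/-- The homomorphism `d♯ : BTer_S(Σ) ⟶ BTer_T(Λ)_{φ♯ × φ♯}` extending a polyderivor. -/
noncomputable def sharp (d : Polyderivor A B) : BenHom (BTer A) (pull (BTer B) d.onSorts) :=
  BTer.lift (pull (BTer B) d.onSorts) fun _ _ σ =>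
    move (BTer B).carrier rfl (by simp) (d.onOps σ)

/-- The underlying mapping of `d♯`. -/
noncomputable def ap (d : Polyderivor A B) {x w : List A.sorts} (P : (BTer A).carrier x w) :
    (BTer B).carrier (x.flatMap d.onSorts) (w.flatMap d.onSorts) :=
  d.sharp.map P

/-- The identity polyderivor. -/
def id (A : Sig.{u}) : Polyderivor A A where
  onSorts s := [s]
  onOps σ := move (BTer A).carrier (flatMap_singleton' _).symm rfl (BTer.gen σ)

/-- The composite `e ∘ d = (ψ♯ ∘ φ, e♯_{φ♯ × φ♯} ∘ d)` of polyderivors. -/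
noncomputable def comp (d : Polyderivor A B) (e : Polyderivor B C) : Polyderivor A C where
  onSorts s := (d.onSorts s).flatMap e.onSorts
  onOps σ := move (BTer C).carrier List.flatMap_assoc rfl (e.ap (d.onOps σ))

theorem ext' {f g : Polyderivor A B} (h : ∀ s, f.onSorts s = g.onSorts s)
    (h' : ∀ {w : List A.sorts} {s : A.sorts} (σ : A.ops w s), f.onOps σ ≍ g.onOps σ) :
    f = g := by
  obtain ⟨f₁, f₂⟩ := f
  obtain ⟨g₁, g₂⟩ := g
  obtain rfl : f₁ = g₁ := funext h
  congr 1
  funext w s σ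
  exact eq_of_heq (h' σ)

theorem onOps_id {w : List A.sorts} {s : A.sorts} (σ : A.ops w s) :
    (id A).onOps σ ≍ BTer.gen σ :=
  move_heq (BTer A).carrier (flatMap_singleton' _).symm rfl (BTer.gen σ)

theorem onOps_comp (d : Polyderivor A B) (e : Polyderivor B C) {w : List A.sorts} {s : A.sorts}
    (σ : A.ops w s) : (d.comp e).onOps σ ≍ e.ap (d.onOps σ) :=
  move_heq (BTer C).carrier List.flatMap_assoc rfl (e.ap (d.onOps σ))

theorem ap_gen (d : Polyderivor A B) {w : List A.sorts} {s : A.sorts} (σ : A.ops w s) :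
    d.ap (BTer.gen σ) = move (BTer B).carrier rfl (by simp) (d.onOps σ) :=
  BTer.lift_gen _ _ σ

theorem ap_move (d : Polyderivor A B) {x x' w w' : List A.sorts} (hx : x = x') (hw : w = w')
    (a : (BTer A).carrier x w) : d.ap (move (BTer A).carrier hx hw a) ≍ d.ap a := by
  subst hx hw
  rfl

theorem ap_heq (d : Polyderivor A B) {x x' w w' : List A.sorts} (hx : x = x') (hw : w = w')
    {a : (BTer A).carrier x w} {b : (BTer A).carrier x' w'} (h : a ≍ b) : d.ap a ≍ d.ap b := by
  subst hx hw
  rw [eq_of_heq h]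

theorem ap_id {x w : List A.sorts} (P : (BTer A).carrier x w) : (id A).ap P ≍ P := by
  have h : (id A).ap P = move (BTer A).carrier (flatMap_singleton' _).symm
      (flatMap_singleton' _).symm P :=
    BTer.hom_ext (h := (id A).sharp) (k := pullUnit (BTer A)) (fun σ => by
      refine (ap_gen _ σ).trans (eq_of_heq ?_)
      refine (move_heq _ _ _ _).trans ((onOps_id σ).trans ?_)
      exact (move_heq (BTer A).carrier (flatMap_singleton' _).symm (flatMap_singleton' _).symm
        (BTer.gen σ)).symm) P
  rw [h]
  exact move_heq _ _ _ _

theorem ap_comp (d : Polyderivor A B) (e : Polyderivor B C) {x w : List A.sorts}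
    (P : (BTer A).carrier x w) : (d.comp e).ap P ≍ e.ap (d.ap P) := by
  have h : (d.comp e).ap P = move (BTer C).carrier List.flatMap_assoc List.flatMap_assoc
      (e.ap (d.ap P)) :=
    BTer.hom_ext (h := (d.comp e).sharp)
      (k := (d.sharp.trans (pullMap e.sharp d.onSorts)).trans (pullAssoc (BTer C) _ _))
      (fun σ => by
        refine (ap_gen _ σ).trans (eq_of_heq ?_)
        change _ ≍ move (BTer C).carrier _ _ (e.ap (d.ap (BTer.gen σ)))
        refine (move_heq _ _ _ _).trans ((onOps_comp d e σ).trans ?_)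
        refine HEq.trans ?_ (move_heq _ _ _ _).symm
        rw [ap_gen]
        exact (ap_move _ _ _ _).symm) P
  rw [h]
  exact move_heq _ _ _ _

end Polyderivor

/-- The category of signatures and polyderivors. -/
noncomputable instance : Category.{u} SigPd.{u} where
  Hom A B := Polyderivor A.sig B.sig
  id A := Polyderivor.id A.sig
  comp d e := Polyderivor.comp d e
  id_comp d := Polyderivor.ext' (fun s => by simp [Polyderivor.comp, Polyderivor.id]) (by
    intro w s σ
    refine (Polyderivor.onOps_comp _ _ σ).trans ((Polyderivor.ap_heq _ (flatMap_singleton' _) rfl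
      (Polyderivor.onOps_id σ)).trans ?_)
    exact (heq_of_eq (Polyderivor.ap_gen d σ)).trans (move_heq _ _ _ _))
  comp_id d := Polyderivor.ext' (fun s => flatMap_singleton' _) (by
    intro w s σ
    exact (Polyderivor.onOps_comp _ _ σ).trans (Polyderivor.ap_id _))
  assoc d e h := Polyderivor.ext' (fun s => List.flatMap_assoc) (by
    intro w s σ
    refine (Polyderivor.onOps_comp _ _ σ).trans ((Polyderivor.ap_heq _ List.flatMap_assoc.symm rfl
      (Polyderivor.onOps_comp _ _ σ)).trans ?_)
    exact ((Polyderivor.onOps_comp _ _ σ).trans (Polyderivor.ap_comp _ _ _)).symm)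

/-! ### Free Bénabou algebras -/

/-- Terms for the operations of Bénabou algebras with generators in `X`. -/
inductive BTerm {S : Type u} (X : List S → List S → Type u) : List S → List S → Type u
  | gen {x w : List S} (a : X x w) : BTerm X x w
  | proj (w : List S) (i : Fin w.length) : BTerm X w [w.get i]
  | tup {x w : List S} (f : ∀ i : Fin w.length, BTerm X x [w.get i]) : BTerm X x w
  | comp {x y w : List S} (a : BTerm X x y) (b : BTerm X y w) : BTerm X x w

/-- The congruence generated by the defining equations of Bénabou algebras. -/
inductive BRel {S : Type u} {X : List S → List S → Type u} :
    ∀ {x w : List S}, BTerm X x w → BTerm X x w → Prop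
  | refl {x w : List S} (a : BTerm X x w) : BRel a a
  | symm {x w : List S} {a b : BTerm X x w} : BRel a b → BRel b a
  | trans {x w : List S} {a b c : BTerm X x w} : BRel a b → BRel b c → BRel a c
  | tup {x w : List S} {f g : ∀ i : Fin w.length, BTerm X x [w.get i]} :
      (∀ i, BRel (f i) (g i)) → BRel (.tup f) (.tup g)
  | comp {x y w : List S} {a a' : BTerm X x y} {b b' : BTerm X y w} :
      BRel a a' → BRel b b' → BRel (.comp a b) (.comp a' b')
  | proj_tup {x w : List S} (f : ∀ i : Fin w.length, BTerm X x [w.get i]) (i : Fin w.length) :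
      BRel (.comp (.tup f) (.proj w i)) (f i)
  | comp_tup_proj {x w : List S} (a : BTerm X x w) : BRel (.comp (.tup (.proj x)) a) a
  | tup_proj {x w : List S} (a : BTerm X x w) : BRel (.tup fun i => .comp a (.proj w i)) a
  | tup_single (s : S) (w : List S) :
      BRel (.tup (w := [s])
        (single (F := fun t => BTerm X (s :: w) [t]) (BTerm.proj (s :: w) ⟨0, by simp⟩)))
        (.proj (s :: w) ⟨0, by simp⟩)
  | assoc {x y z w : List S} (c : BTerm X x y) (b : BTerm X y z) (a : BTerm X z w) :
      BRel (.comp (.comp c b) a) (.comp c (.comp b a))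

instance BTerm.setoid {S : Type u} (X : List S → List S → Type u) (x w : List S) :
    Setoid (BTerm X x w) :=
  ⟨BRel, BRel.refl, BRel.symm, BRel.trans⟩

theorem BRel.mk_out {S : Type u} {X : List S → List S → Type u} {x w : List S}
    (a : BTerm X x w) : BRel (⟦a⟧ : Quotient (BTerm.setoid X x w)).out a :=
  Quotient.mk_out a

/-- The free Bénabou algebra `T_{B_S}(X)` on the `S* × S*`-sorted set `X`. -/
noncomputable def Free {S : Type u} (X : List S → List S → Type u) : BenAlg S where
  carrier x w := Quotient (BTerm.setoid X x w)
  proj w i := ⟦.proj w i⟧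
  tup f := ⟦.tup fun i => (f i).out⟧
  comp := Quotient.map₂ .comp fun _ _ h _ _ h' => BRel.comp h h'
  proj_tup f i := (Quotient.sound (BRel.proj_tup _ i)).trans (Quotient.out_eq _)
  comp_tup_proj := by
    rintro x w ⟨a⟩
    exact Quotient.sound ((BRel.comp (BRel.tup fun i => BRel.mk_out _) (.refl _)).trans
      (BRel.comp_tup_proj a))
  tup_proj := by
    rintro x w ⟨a⟩
    exact Quotient.sound ((BRel.tup fun i => BRel.mk_out (.comp a (.proj w i))).trans
      (BRel.tup_proj a))
  tup_single s w := by
    refine Quotient.sound (BRel.trans (BRel.tup fun i => ?_) (BRel.tup_single s w))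
    obtain rfl : i = ⟨0, by simp⟩ := Subsingleton.elim (α := Fin 1) _ _
    exact BRel.mk_out (.proj (s :: w) ⟨0, by simp⟩)
  assoc := by
    rintro x y z w ⟨c⟩ ⟨b⟩ ⟨a⟩
    exact Quotient.sound (BRel.assoc c b a)

section FreeLift

variable {S : Type u} {X : List S → List S → Type u}

/-- The class of a term. -/
def Free.mk {x w : List S} (a : BTerm X x w) : (Free X).carrier x w :=
  (⟦a⟧ : Quotient (BTerm.setoid X x w))

/-- The insertion of generators `η^{B_S}`. -/
def Free.gen {x w : List S} (a : X x w) : (Free X).carrier x w := Free.mk (.gen a)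

variable (A : BenAlg S) (f : ∀ x w : List S, X x w → A.carrier x w)

/-- The value of a term in a Bénabou algebra. -/
def BTerm.eval : ∀ {x w : List S}, BTerm X x w → A.carrier x w
  | _, _, .gen a => f _ _ a
  | _, _, .proj w i => A.proj w i
  | _, _, .tup g => A.tup fun i => (g i).eval
  | _, _, .comp a b => A.comp a.eval b.eval

theorem BRel.eval {x w : List S} {a b : BTerm X x w} (h : BRel a b) :
    a.eval A f = b.eval A f := by
  induction h with
  | refl a => rfl
  | symm _ ih => exact ih.symm
  | trans _ _ ih ih' => exact ih.trans ih'
  | tup _ ih => exact congrArg A.tup (funext ih)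
  | comp _ _ ih ih' => exact congrArg₂ A.comp ih ih'
  | proj_tup g i => exact A.proj_tup _ i
  | comp_tup_proj a => exact A.comp_tup_proj _
  | tup_proj a => exact A.tup_proj _
  | tup_single s w =>
    refine Eq.trans (congrArg A.tup (funext fun i => ?_)) (A.tup_single s w)
    obtain rfl : i = ⟨0, by simp⟩ := Subsingleton.elim (α := Fin 1) _ _
    rfl
  | assoc c b a => exact A.assoc _ _ _

/-- The homomorphism `f♯` from the free Bénabou algebra on `X` to `A` that extends `f`. -/
def Free.lift : BenHom (Free X) A where
  map := Quotient.lift (fun a => a.eval A f) fun _ _ h => BRel.eval A f h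
  map_proj w i := rfl
  map_tup g := by
    refine congrArg A.tup (funext fun i => ?_)
    conv_rhs => rw [← Quotient.out_eq (g i)]
    rfl
  map_comp := by
    rintro x y w ⟨a⟩ ⟨b⟩
    rfl

theorem Free.lift_gen {x w : List S} (a : X x w) : (Free.lift A f).map (Free.gen a) = f x w a := rfl

variable {A}

/-- Homomorphisms on a free Bénabou algebra are determined by their values on the generators. -/
theorem Free.hom_ext {h k : BenHom (Free X) A}
    (e : ∀ {x w : List S} (a : X x w), h.map (Free.gen a) = k.map (Free.gen a))
    {x w : List S} (P : (Free X).carrier x w) : h.map P = k.map P := by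
  have key : ∀ {x w : List S} (a : BTerm X x w), h.map (Free.mk a) = k.map (Free.mk a) := by
    intro x w a
    induction a with
    | gen a => exact e a
    | proj w i => exact (h.map_proj w i).trans (k.map_proj w i).symm
    | @tup x w g ih =>
      have : Free.mk (.tup g) = (Free X).tup fun i => Free.mk (g i) :=
        Quotient.sound (BRel.tup fun i => (BRel.mk_out (g i)).symm)
      rw [this, h.map_tup, k.map_tup]
      exact congrArg A.tup (funext ih)
    | comp a b ih ih' =>
      have : Free.mk (.comp a b) = (Free X).comp (Free.mk a) (Free.mk b) := rfl
      rw [this, h.map_comp, k.map_comp, ih, ih']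
  obtain ⟨a⟩ := P
  exact key a

end FreeLift

/-- The multiplication `μ^{B_S}` of the monad of free Bénabou algebras. -/
noncomputable def freeMul {S : Type u} (X : List S → List S → Type u) :
    BenHom (Free (Free X).carrier) (Free X) :=
  Free.lift (Free X) fun _ _ a => a

/-- The `S* × S*`-sorted set `∐_{1 × (·)} Σ` of an `S* × S`-sorted set `Σ`: its component
at `(w, v)` consists of the `σ ∈ Σ_{w,s}` with `v = (s)`. -/
inductive Coprod {S : Type u} (X : List S → S → Type u) : List S → List S → Type u
  | mk {w : List S} {s : S} (σ : X w s) : Coprod X w [s]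

/-- The extension to `∐_{1 × (·)} Σ` of an `S* × S`-sorted mapping. -/
def Coprod.desc {S : Type u} {X : List S → S → Type u} {Y : List S → List S → Type u}
    (f : ∀ (w : List S) (s : S), X w s → Y w [s]) :
    ∀ w v : List S, Coprod X w v → Y w v
  | _, _, .mk σ => f _ _ σ

/-! ### The data of the monad of polyderivors -/

/-- The merging `λ_S : S** → S*` of strings of words, i.e. the extension `(1_{S*})♯`. -/
abbrev merge {S : Type u} (w : List (List S)) : List S := w.flatMap _root_.id

theorem merge_map_eq {S T : Type u} (φ : S → List T) (w : List S) :
    merge (w.map φ) = w.flatMap φ := by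
  induction w <;> simp_all [merge]

theorem merge_singletons {S : Type u} (w : List S) : merge (w.map fun s => [s]) = w := by
  rw [merge_map_eq, flatMap_singleton']

theorem merge_map {S T : Type u} (φ : S → T) (x : List (List S)) :
    (merge x).map φ = merge (x.map (List.map φ)) := by
  rw [merge_map_eq, merge, List.map_flatMap]
  rfl

theorem merge_merge {S : Type u} (x : List (List (List S))) :
    merge (merge x) = merge (x.map merge) := by
  rw [merge_map_eq]
  exact List.flatMap_assoc

/-- The free Bénabou algebra `T_{B_S}(∐ Σ)`. -/
noncomputable abbrev FreeSig (A : Sig.{u}) : BenAlg A.sorts := Free (Coprod A.ops)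

/-- The signature `pd(Σ) = (S*, T_{B_S}(∐ Σ)_{λ_S × 1})`. -/
noncomputable def pdObj (A : Sig.{u}) : Sig.{u} where
  sorts := List A.sorts
  ops x w := (FreeSig A).carrier (merge x) w

theorem flatMap_map {S T : Type u} (φ : S → T) (w : List S) :
    w.flatMap (fun s => [φ s]) = w.map φ := by
  induction w <;> simp_all

/-- The homomorphism `d♯ : T_{B_S}(∐ Σ) ⟶ T_{B_T}(∐ Λ)_{φ* × φ*}` induced by a signature morphism
`(φ, d)`, where `φ* = ((·) ∘ φ)♯`. -/
noncomputable def pdSharp {A B : Sig.{u}} (d : A ⟶ B) :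
    BenHom (FreeSig A) (pull (FreeSig B) fun s => [d.onSorts s]) :=
  Free.lift _ (Coprod.desc fun _ _ σ =>
    move (FreeSig B).carrier (flatMap_map _ _).symm (by simp) (Free.gen (Coprod.mk (d.onOps σ))))

/-- The signature morphism `pd(d) = (φ*, (d♯)_{λ_S × 1})`. -/
noncomputable def pdMap {A B : Sig.{u}} (d : A ⟶ B) : pdObj A ⟶ pdObj B where
  onSorts w := w.map d.onSorts
  onOps {x _} P := move (FreeSig B).carrier
    ((flatMap_map _ _).trans (merge_map d.onSorts x)) (flatMap_map _ _) ((pdSharp d).map P)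

/-- The unit at `Σ`: sorts go to one-letter words and operations to generators. -/
noncomputable def pdUnit (A : Sig.{u}) : A ⟶ pdObj A where
  onSorts s := [s]
  onOps {w _} σ := move (FreeSig A).carrier (merge_singletons w).symm rfl
    (Free.gen (Coprod.mk σ))

/-- The component `α_Θ : T_{B_{S*}}(∐ Θ_{λ_S × 1}) ⟶ T_{B_S}(Θ)_{λ_S × λ_S}`: the homomorphism
of Bénabou algebras for `S*` that extends the insertion of generators `Θ ⟶ T_{B_S}(Θ)`, the
structure on its codomain being given by the derivor `b^{λ_S}`. -/
noncomputable def alpha {S : Type u} (X : List S → List S → Type u) :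
    BenHom (Free (Coprod fun (x : List (List S)) (w : List S) => X (merge x) w))
      (pull (Free X) (_root_.id : List S → List S)) :=
  Free.lift _ (Coprod.desc fun _ _ a => move (Free X).carrier rfl (by simp) (Free.gen a))

/-- The multiplication at `Σ`: on sorts it is `λ_S`, on operations it is `α` at
`T_{B_S}(∐ Σ)` followed by `μ^{B_S}` at `∐ Σ`. -/
noncomputable def pdMul (A : Sig.{u}) : pdObj (pdObj A) ⟶ pdObj A where
  onSorts w := merge w
  onOps {x _} P := move (FreeSig A).carrier (merge_merge x) rfl
    ((freeMul (Coprod A.ops)).map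
      ((alpha (FreeSig A).carrier).map P))

/-- The canonical homomorphism `BTer_T(Λ) ⟶ T_{B_T}(∐ Λ)` that preserves the operations of `Λ`. -/
noncomputable def bterToFree (A : Sig.{u}) : BenHom (BTer A) (FreeSig A) :=
  BTer.lift (FreeSig A) fun _ _ σ => Free.gen (Coprod.mk σ)

/-- The signature morphism `Σ ⟶ pd(Λ)` that corresponds to a polyderivor from `Σ` to `Λ`. -/
noncomputable def Polyderivor.toSigHom {A B : Sig.{u}} (d : Polyderivor A B) : A ⟶ pdObj B where
  onSorts := d.onSorts
  onOps {w _} σ := move (FreeSig B).carrier (merge_map_eq d.onSorts w).symm rfl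
    ((bterToFree B).map (d.onOps σ))

end ManySorted

/-! Every structure map of the monad is, on operations, a restriction of a homomorphism of Bénabou
algebras out of a free one, and such a homomorphism is determined by its values on the operations of
the signature. The change of sorts `pull` is functorial and compatible with composing sort maps, so
homomorphisms A → B_{φ♯×φ♯} and B → C_{ψ♯×ψ♯} compose to A → C over ψ♯ ∘ φ (`BenHom.transPull`). An
equation between morphisms into some pd(Λ) thus reduces to an equation of sort maps, which concerns
words only, and, where the operation in question is not already a generator, to a comparison of two
homomorphisms on generators.

The generator computations rest on one fact, `pdMulHom_ofOp`: the homomorphism behind μ sends the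
generator named by an operation P of pd(Σ) to P itself. One unit law is exactly this fact. For the
other unit law, associativity and naturality of μ, it makes the two homomorphisms in question agree
on generators.

For the Kleisli category, `BTer` and `FreeSig` are both free on the operations, so κ = `bterToFree`
is invertible with inverse `freeToBTer`; this makes polyderivors and morphisms Σ → pd(Λ) correspond
bijectively. Composition is respected because κ carries e♯ to the Kleisli extension of e
(`bterToFree_ap`), which is again checked on generators. The inverse functor then needs no separate
verification.

The remaining difficulty is bookkeeping: words such as (ψ♯ ∘ φ)♯(w) and ψ♯(φ♯(w)) are equal but not
definitionally, so elements are compared in the total space of the family (`Same`), where transports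
disappear. -/

namespace ManySorted

/-! ### Equality up to transport -/

/-- Equality of two members of a family indexed by two indices, regardless of the components they
lie in. -/
def Same {I J : Type*} (F : I → J → Type v) {i i' : I} {j j' : J} (a : F i j) (b : F i' j') :
    Prop :=
  (⟨i, j, a⟩ : Σ i, Σ j, F i j) = ⟨i', j', b⟩

namespace Same

variable {I J : Type*} {F : I → J → Type v}

theorem symm {i i' : I} {j j' : J} {a : F i j} {b : F i' j'} (h : Same F a b) : Same F b a :=
  Eq.symm h

theorem trans {i i' i'' : I} {j j' j'' : J} {a : F i j} {b : F i' j'} {c : F i'' j''}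
    (h : Same F a b) (h' : Same F b c) : Same F a c :=
  Eq.trans h h'

theorem eq {i : I} {j : J} {a b : F i j} (h : Same F a b) : a = b := by
  simpa [Same] using h

theorem of_eq {i : I} {j : J} {a b : F i j} (h : a = b) : Same F a b := h ▸ rfl

theorem heq {i i' : I} {j j' : J} {a : F i j} {b : F i' j'} (h : Same F a b) : a ≍ b := by
  cases h
  rfl

/-- Heterogeneous equality only identifies the component types, which does not determine their
indices; the index equalities must therefore be supplied. `Same` carries them itself. -/
theorem of_heq {i i' : I} {j j' : J} {a : F i j} {b : F i' j'} (hi : i = i') (hj : j = j')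
    (h : a ≍ b) : Same F a b := by
  subst hi hj
  exact of_eq (eq_of_heq h)

theorem move_eq {i i' : I} {j j' : J} {a : F i j} {b : F i' j'} (h : Same F a b) (hi : i = i')
    (hj : j = j') : move F hi hj a = b := by
  subst hi hj
  exact h.eq

end Same

theorem same_move {I J : Type*} (F : I → J → Type v) {i i' : I} {j j' : J} (hi : i = i')
    (hj : j = j') (a : F i j) : Same F (move F hi hj a) a := by
  subst hi hj
  rfl

/-! ### Signature morphisms -/

namespace SigHom

variable {A B C : Sig.{u}}

theorem ext_same {f g : A ⟶ B} (h : ∀ s, f.onSorts s = g.onSorts s)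
    (h' : ∀ {w : List A.sorts} {s : A.sorts} (σ : A.ops w s),
      Same B.ops (f.onOps σ) (g.onOps σ)) : f = g :=
  SigHom.ext' h fun σ => (h' σ).move_eq _ _

theorem id_onOps {w : List A.sorts} {s : A.sorts} (σ : A.ops w s) :
    Same A.ops ((𝟙 A : A ⟶ A).onOps σ) σ :=
  same_move _ _ rfl _

theorem comp_onOps (f : A ⟶ B) (g : B ⟶ C) {w : List A.sorts} {s : A.sorts} (σ : A.ops w s) :
    Same C.ops ((f ≫ g).onOps σ) (g.onOps (f.onOps σ)) :=
  same_move _ _ rfl _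

end SigHom

/-! ### Homomorphisms into a change of sorts -/

section PullHom

variable {S T U : Type u}

theorem BenHom.map_same {A B : BenAlg S} (h : BenHom A B) {x x' w w' : List S}
    {a : A.carrier x w} {b : A.carrier x' w'} (e : Same A.carrier a b) :
    Same B.carrier (h.map a) (h.map b) := by
  cases e
  rfl

/-- In contrast to `BenHom.map_same`, the values are compared over words on `T`, in `B` itself. This
forgets the words on `S` that index `pull B φ`, and makes homomorphisms along different sort maps
comparable. -/
theorem BenHom.map_same_pull {A : BenAlg S} {B : BenAlg T} {φ : S → List T}
    (h : BenHom A (pull B φ)) {x x' w w' : List S} {a : A.carrier x w} {b : A.carrier x' w'}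
    (e : Same A.carrier a b) : Same B.carrier (h.map a) (h.map b) := by
  cases e
  rfl

/-- The composite of homomorphisms `A ⟶ B_{φ♯ × φ♯}` and `B ⟶ C_{ψ♯ × ψ♯}`. -/
noncomputable def BenHom.transPull {A : BenAlg S} {B : BenAlg T} {C : BenAlg U} {φ : S → List T}
    {ψ : T → List U} (h : BenHom A (pull B φ)) (k : BenHom B (pull C ψ)) :
    BenHom A (pull C fun s => (φ s).flatMap ψ) :=
  (h.trans (pullMap k φ)).trans (pullAssoc C φ ψ)

/-- The factor `pullAssoc` contributes only a transport along the associativity of `flatMap`, which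
`Same` ignores. -/
theorem BenHom.transPull_map {A : BenAlg S} {B : BenAlg T} {C : BenAlg U} {φ : S → List T}
    {ψ : T → List U} (h : BenHom A (pull B φ)) (k : BenHom B (pull C ψ)) {x w : List S}
    (a : A.carrier x w) : Same C.carrier ((h.transPull k).map a) (k.map (h.map a)) :=
  same_move _ _ _ _

theorem pullUnit_map (A : BenAlg S) {x w : List S} (a : A.carrier x w) :
    Same A.carrier ((pullUnit A).map a) a :=
  same_move _ _ _ _

end PullHom

/-! ### The free Bénabou algebra on a signature -/

namespace FreeSig

variable {A : Sig.{u}} {T : Type u} {B : BenAlg T}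

/-- The generator given by an operation. -/
noncomputable def ofOp {w : List A.sorts} {s : A.sorts} (σ : A.ops w s) :
    (FreeSig A).carrier w [s] :=
  Free.gen (Coprod.mk σ)

theorem ofOp_same {w w' : List A.sorts} {s s' : A.sorts} {σ : A.ops w s} {τ : A.ops w' s'}
    (h : Same A.ops σ τ) : Same (FreeSig A).carrier (ofOp σ) (ofOp τ) := by
  cases h
  rfl

theorem hom_ext {C : BenAlg A.sorts} {h k : BenHom (FreeSig A) C}
    (e : ∀ {w : List A.sorts} {s : A.sorts} (σ : A.ops w s), h.map (ofOp σ) = k.map (ofOp σ))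
    {x w : List A.sorts} (P : (FreeSig A).carrier x w) : h.map P = k.map P :=
  Free.hom_ext (fun a => by cases a with | mk σ => exact e σ) P

/-- The form of uniqueness used for the monad laws: the two sort maps are usually only
propositionally equal (for example up to `++ []`), so the two targets are different algebras until
function extensionality identifies them. -/
theorem hom_same {φ ψ : A.sorts → List T} (hφ : ∀ s, φ s = ψ s)
    (h : BenHom (FreeSig A) (pull B φ)) (k : BenHom (FreeSig A) (pull B ψ))
    (e : ∀ {w : List A.sorts} {s : A.sorts} (σ : A.ops w s),
      Same B.carrier (h.map (ofOp σ)) (k.map (ofOp σ)))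
    {x w : List A.sorts} (P : (FreeSig A).carrier x w) :
    Same B.carrier (h.map P) (k.map P) := by
  obtain rfl : φ = ψ := funext hφ
  exact .of_eq (hom_ext (fun σ => (e σ).eq) P)

end FreeSig

theorem BTer.hom_same {A : Sig.{u}} {T : Type u} {B : BenAlg T} {φ ψ : A.sorts → List T}
    (hφ : ∀ s, φ s = ψ s) (h : BenHom (BTer A) (pull B φ)) (k : BenHom (BTer A) (pull B ψ))
    (e : ∀ {w : List A.sorts} {s : A.sorts} (σ : A.ops w s),
      Same B.carrier (h.map (BTer.gen σ)) (k.map (BTer.gen σ)))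
    {x w : List A.sorts} (P : (BTer A).carrier x w) :
    Same B.carrier (h.map P) (k.map P) := by
  obtain rfl : φ = ψ := funext hφ
  exact .of_eq (BTer.hom_ext (fun σ => (e σ).eq) P)

/-! ### The monad of polyderivors -/

section Monad

variable {A B C : Sig.{u}}

/-! ### The structure maps on generators -/

theorem pdSharp_ofOp (d : A ⟶ B) {w : List A.sorts} {s : A.sorts} (σ : A.ops w s) :
    Same (FreeSig B).carrier ((pdSharp d).map (FreeSig.ofOp σ)) (FreeSig.ofOp (d.onOps σ)) :=
  same_move _ _ rfl _

theorem pdMap_onOps (d : A ⟶ B) {x : List (List A.sorts)} {w : List A.sorts}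
    (P : (FreeSig A).carrier (merge x) w) :
    Same (FreeSig B).carrier ((pdMap d).onOps (w := x) (s := w) P) ((pdSharp d).map P) :=
  same_move _ _ _ _

theorem pdUnit_onOps {w : List A.sorts} {s : A.sorts} (σ : A.ops w s) :
    Same (FreeSig A).carrier ((pdUnit A).onOps σ) (FreeSig.ofOp σ) :=
  same_move _ _ rfl _

/-- The multiplication on operations, as a homomorphism of Bénabou algebras. -/
noncomputable def pdMulHom (A : Sig.{u}) :
    BenHom (FreeSig (pdObj A)) (pull (FreeSig A) (_root_.id : List A.sorts → List A.sorts)) :=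
  (alpha (FreeSig A).carrier).trans (pullMap (freeMul (Coprod A.ops)) _root_.id)

/-- α inserts `P` as a generator of the free algebra on Θ, and μ of the free Bénabou algebra monad
evaluates that generator back to `P`: this is the law μ ∘ η = 1 there. -/
theorem pdMulHom_ofOp {x : List (List A.sorts)} {w : List A.sorts} (P : (pdObj A).ops x w) :
    Same (FreeSig A).carrier (i' := merge x) (j' := w)
      ((pdMulHom A).map (FreeSig.ofOp P)) P :=
  (freeMul (Coprod A.ops)).map_same (same_move _ rfl _ _)

/-- Identifies the multiplication with a restriction of a homomorphism, so that uniqueness of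
homomorphisms becomes applicable to it. -/
theorem pdMul_onOps {x : List (List (List A.sorts))} {w : List (List A.sorts)}
    (P : (FreeSig (pdObj A)).carrier (merge x) w) :
    Same (FreeSig A).carrier ((pdMul A).onOps (w := x) (s := w) P) ((pdMulHom A).map P) :=
  same_move _ _ rfl _

/-! ### Passing between pd(Λ) and the free algebra -/

/-- Operations of `pd(Λ)` of equal arity are equal as soon as they are equal in the free Bénabou
algebra. -/
theorem pdObj_same {x x' : List (List B.sorts)} {w w' : List B.sorts} {P : (pdObj B).ops x w}
    {Q : (pdObj B).ops x' w'} (hx : x = x')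
    (h : Same (FreeSig B).carrier (i := merge x) (i' := merge x') (j := w) (j' := w') P Q) :
    Same (pdObj B).ops P Q := by
  -- The arity has to be given, since `merge` is not injective; the coarity is not merged and can be
  -- read off from `h`.
  subst hx
  have hw : w = w' := by
    cases h
    rfl
  exact .of_heq rfl hw h.heq

theorem same_of_pdObj {x x' : List (List B.sorts)} {w w' : List B.sorts} {P : (pdObj B).ops x w}
    {Q : (pdObj B).ops x' w'} (h : Same (pdObj B).ops P Q) :
    Same (FreeSig B).carrier (i := merge x) (i' := merge x') (j := w) (j' := w') P Q := by
  cases h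
  rfl

/-- Agreement on sorts already fixes the arities, so operations may be compared in the free algebra,
over merged words. All equations between signature morphisms below are proved through this
criterion. -/
theorem ext_pdObj {f g : A ⟶ pdObj B} (h : ∀ s, f.onSorts s = g.onSorts s)
    (h' : ∀ {w : List A.sorts} {s : A.sorts} (σ : A.ops w s),
      Same (FreeSig B).carrier (i := merge (w.map f.onSorts)) (i' := merge (w.map g.onSorts))
        (j := f.onSorts s) (j' := g.onSorts s) (f.onOps σ) (g.onOps σ)) : f = g :=
  SigHom.ext_same h fun σ =>
    pdObj_same (List.map_congr_left fun s _ => h s) (h' σ)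

theorem comp_onOps_pdObj (f : A ⟶ B) (g : B ⟶ pdObj C) {w : List A.sorts} {s : A.sorts}
    (σ : A.ops w s) :
    Same (FreeSig C).carrier (i := merge (w.map (f ≫ g).onSorts)) (j := (f ≫ g).onSorts s)
      (i' := merge ((w.map f.onSorts).map g.onSorts)) (j' := g.onSorts (f.onSorts s))
      ((f ≫ g).onOps σ) (g.onOps (f.onOps σ)) :=
  same_of_pdObj (SigHom.comp_onOps f g σ)

theorem comp_pdMap_onOps (f : A ⟶ pdObj B) (g : B ⟶ C) {w : List A.sorts} {s : A.sorts}
    (σ : A.ops w s) :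
    Same (FreeSig C).carrier (i := merge (w.map (f ≫ pdMap g).onSorts))
      (j := (f ≫ pdMap g).onSorts s) ((f ≫ pdMap g).onOps σ)
      ((pdSharp g).map (x := merge (w.map f.onSorts)) (w := f.onSorts s) (f.onOps σ)) :=
  (comp_onOps_pdObj f (pdMap g) σ).trans (pdMap_onOps g (x := w.map f.onSorts) _)

theorem comp_pdMul_onOps (f : A ⟶ pdObj (pdObj B)) {w : List A.sorts} {s : A.sorts}
    (σ : A.ops w s) :
    Same (FreeSig B).carrier (i := merge (w.map (f ≫ pdMul B).onSorts))
      (j := (f ≫ pdMul B).onSorts s) ((f ≫ pdMul B).onOps σ)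
      ((pdMulHom B).map (x := merge (w.map f.onSorts)) (w := f.onSorts s) (f.onOps σ)) :=
  (comp_onOps_pdObj f (pdMul B) σ).trans (pdMul_onOps (x := w.map f.onSorts) _)

/-! ### Functoriality of pd -/

theorem pdMap_id (A : Sig.{u}) : pdMap (𝟙 A) = 𝟙 (pdObj A) :=
  ext_pdObj (fun s => List.map_id s) fun {x w} P =>
    ((pdMap_onOps (𝟙 A) (x := x) (w := w) P).trans
      -- The homomorphism induced by the identity lands in the change of sorts along s ↦ (s), so it
      -- is compared with `pullUnit`, which is the identity up to transport.
      ((FreeSig.hom_same (fun _ => rfl) (pdSharp (𝟙 A)) (pullUnit (FreeSig A))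
        (fun σ => (pdSharp_ofOp (𝟙 A) σ).trans
          ((FreeSig.ofOp_same (SigHom.id_onOps σ)).trans (pullUnit_map _ _).symm)) P).trans
      (pullUnit_map _ _))).trans (same_of_pdObj (SigHom.id_onOps (A := pdObj A) P)).symm

theorem pdSharp_comp (d : A ⟶ B) (e : B ⟶ C) {x w : List A.sorts}
    (P : (FreeSig A).carrier x w) :
    Same (FreeSig C).carrier ((pdSharp (d ≫ e)).map P) ((pdSharp e).map ((pdSharp d).map P)) :=
  (FreeSig.hom_same (fun _ => rfl) (pdSharp (d ≫ e)) ((pdSharp d).transPull (pdSharp e))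
    (fun σ => (pdSharp_ofOp _ σ).trans <| (FreeSig.ofOp_same (SigHom.comp_onOps d e σ)).trans <|
      ((BenHom.transPull_map _ _ _).trans <|
        ((pdSharp e).map_same_pull (pdSharp_ofOp d σ)).trans (pdSharp_ofOp e _)).symm) P).trans
  (BenHom.transPull_map _ _ _)

theorem pdMap_comp (d : A ⟶ B) (e : B ⟶ C) : pdMap (d ≫ e) = pdMap d ≫ pdMap e :=
  ext_pdObj (fun _ => (List.map_map (g := e.onSorts) (f := d.onSorts)).symm) fun {x w} P =>
    (pdMap_onOps (d ≫ e) (x := x) (w := w) P).trans <| (pdSharp_comp d e _).trans <|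
      ((comp_pdMap_onOps (pdMap d) e (w := x) (s := w) P).trans <|
        (pdSharp e).map_same_pull (pdMap_onOps d (x := x) (w := w) P)).symm

/-! ### Naturality of the unit and the multiplication -/

theorem pdUnit_naturality (d : A ⟶ B) : d ≫ pdUnit B = pdUnit A ≫ pdMap d :=
  ext_pdObj (fun _ => rfl) fun σ =>
    ((comp_onOps_pdObj d (pdUnit B) σ).trans (pdUnit_onOps _)).trans <|
      ((comp_pdMap_onOps (pdUnit A) d σ).trans <|
        ((pdSharp d).map_same_pull (pdUnit_onOps σ)).trans (pdSharp_ofOp d σ)).symm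

theorem pdMulHom_naturality (d : A ⟶ B) {x w : List (List A.sorts)}
    (P : (FreeSig (pdObj A)).carrier x w) :
    Same (FreeSig B).carrier ((pdMulHom B).map ((pdSharp (pdMap d)).map P))
      ((pdSharp d).map ((pdMulHom A).map P)) :=
  (BenHom.transPull_map _ _ _).symm.trans <|
    -- Both composites lie over w ↦ d*(w), once as the merging of a one-word string (hence `++ []`)
    -- and once as a `flatMap` of singletons. On the generator given by an operation σ of pd(Σ),
    -- both yield d♯(σ).
    (FreeSig.hom_same (fun _ => (List.append_nil _).trans (flatMap_map _ _).symm)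
      ((pdSharp (pdMap d)).transPull (pdMulHom B)) ((pdMulHom A).transPull (pdSharp d))
      (fun {x w} σ => (BenHom.transPull_map _ _ _).trans <|
        ((pdMulHom B).map_same_pull (pdSharp_ofOp (pdMap d) σ)).trans <|
        (pdMulHom_ofOp _).trans <| (pdMap_onOps d (x := x) (w := w) σ).trans <|
        ((BenHom.transPull_map _ _ _).trans <|
          (pdSharp d).map_same_pull (pdMulHom_ofOp σ)).symm) P).trans <|
    BenHom.transPull_map _ _ _

theorem pdMul_naturality (d : A ⟶ B) : pdMap (pdMap d) ≫ pdMul B = pdMul A ≫ pdMap d :=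
  ext_pdObj (fun x => (merge_map d.onSorts x).symm) fun {x w} P =>
    (comp_pdMul_onOps (pdMap (pdMap d)) (w := x) (s := w) P).trans <|
      ((pdMulHom B).map_same_pull (pdMap_onOps (pdMap d) (x := x) (w := w) P)).trans <|
      (pdMulHom_naturality d _).trans <|
      ((comp_pdMap_onOps (pdMul A) d (w := x) (s := w) P).trans <|
        (pdSharp d).map_same_pull (pdMul_onOps (x := x) (w := w) P)).symm

/-! ### The monad laws -/

theorem pdUnit_pdMul (A : Sig.{u}) : pdUnit (pdObj A) ≫ pdMul A = 𝟙 (pdObj A) :=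
  ext_pdObj (fun _ => List.append_nil _) fun {x w} P =>
    (comp_pdMul_onOps (pdUnit (pdObj A)) (w := x) (s := w) P).trans <|
      ((pdMulHom A).map_same_pull (pdUnit_onOps (A := pdObj A) P)).trans <|
      -- The unit of pd(Σ) makes `P` a generator, so evaluation on generators finishes this law; no
      -- comparison of homomorphisms is needed.
      (pdMulHom_ofOp P).trans (same_of_pdObj (SigHom.id_onOps (A := pdObj A) P)).symm

theorem pdMap_pdUnit_pdMul (A : Sig.{u}) : pdMap (pdUnit A) ≫ pdMul A = 𝟙 (pdObj A) :=
  ext_pdObj (fun s => merge_singletons s) fun {x w} P =>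
    (comp_pdMul_onOps (pdMap (pdUnit A)) (w := x) (s := w) P).trans <|
      ((pdMulHom A).map_same_pull (pdMap_onOps (pdUnit A) (x := x) (w := w) P)).trans <|
      (BenHom.transPull_map _ _ _).symm.trans <|
      -- Here `P` is an arbitrary element of the free algebra, so the identity, in the guise of
      -- `pullUnit`, is compared with the composite on generators: σ goes to the generator named by
      -- η(σ), and then back to η(σ), which is σ as a generator.
      (FreeSig.hom_same (fun _ => List.append_nil _)
        ((pdSharp (pdUnit A)).transPull (pdMulHom A)) (pullUnit (FreeSig A))
        (fun σ => (BenHom.transPull_map _ _ _).trans <|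
          ((pdMulHom A).map_same_pull (pdSharp_ofOp _ σ)).trans <|
          (pdMulHom_ofOp _).trans <| (pdUnit_onOps σ).trans (pullUnit_map _ _).symm) P).trans <|
      (pullUnit_map _ _).trans (same_of_pdObj (SigHom.id_onOps (A := pdObj A) P)).symm

theorem pdMul_assoc (A : Sig.{u}) : pdMap (pdMul A) ≫ pdMul A = pdMul (pdObj A) ≫ pdMul A :=
  ext_pdObj (fun s => (merge_merge s).symm) fun {x w} P =>
    (comp_pdMul_onOps (pdMap (pdMul A)) (w := x) (s := w) P).trans <|
      ((pdMulHom A).map_same_pull (pdMap_onOps (pdMul A) (x := x) (w := w) P)).trans <|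
      (BenHom.transPull_map _ _ _).symm.trans <|
      -- On the generator given by an operation σ of pd(pd(Σ)), one side applies μ to σ and then
      -- names and evaluates the result, the other evaluates the name of σ and then applies μ; both
      -- give μ(σ).
      (FreeSig.hom_same (fun _ => List.append_nil _)
        ((pdSharp (pdMul A)).transPull (pdMulHom A)) ((pdMulHom (pdObj A)).transPull (pdMulHom A))
        (fun {x w} σ => (BenHom.transPull_map _ _ _).trans <|
          ((pdMulHom A).map_same_pull (pdSharp_ofOp _ σ)).trans <|
          (pdMulHom_ofOp _).trans <| (pdMul_onOps (x := x) (w := w) σ).trans <|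
          ((BenHom.transPull_map _ _ _).trans <|
            (pdMulHom A).map_same_pull (pdMulHom_ofOp σ)).symm) P).trans <|
      (BenHom.transPull_map _ _ _).trans <|
      ((comp_pdMul_onOps (pdMul (pdObj A)) (w := x) (s := w) P).trans <|
        (pdMulHom A).map_same_pull (pdMul_onOps (x := x) (w := w) P)).symm

/-- The monad of polyderivors on the category of signatures. -/
noncomputable def pdMonad : Monad Sig.{u} where
  obj := pdObj
  map := pdMap
  map_id := pdMap_id
  map_comp := pdMap_comp
  η := { app := pdUnit, naturality := fun _ _ d => pdUnit_naturality d }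
  μ := { app := pdMul, naturality := fun _ _ d => pdMul_naturality d }
  assoc := pdMul_assoc
  left_unit := pdUnit_pdMul
  right_unit := pdMap_pdUnit_pdMul

end Monad

/-! ### Polyderivors as Kleisli morphisms -/

/-- The canonical homomorphism from the free Bénabou algebra on a signature to its algebra of
terms. -/
noncomputable def freeToBTer (A : Sig.{u}) : BenHom (FreeSig A) (BTer A) :=
  Free.lift (BTer A) (Coprod.desc fun _ _ σ => BTer.gen σ)

/-- The identity homomorphism. -/
def BenHom.refl {S : Type u} (A : BenAlg S) : BenHom A A where
  map a := a
  map_proj _ _ := rfl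
  map_tup _ := rfl
  map_comp _ _ := rfl

theorem bterToFree_gen {A : Sig.{u}} {w : List A.sorts} {s : A.sorts} (σ : A.ops w s) :
    (bterToFree A).map (BTer.gen σ) = FreeSig.ofOp σ :=
  BTer.lift_gen _ _ σ

/-- Both algebras are free on the same operations; the round trip fixes each operation and is
therefore the identity. -/
theorem freeToBTer_bterToFree {A : Sig.{u}} {x w : List A.sorts} (P : (BTer A).carrier x w) :
    (freeToBTer A).map ((bterToFree A).map P) = P :=
  BTer.hom_ext (h := (bterToFree A).trans (freeToBTer A)) (k := BenHom.refl _)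
    (fun σ => congrArg (freeToBTer A).map (bterToFree_gen σ)) P

theorem bterToFree_freeToBTer {A : Sig.{u}} {x w : List A.sorts}
    (P : (FreeSig A).carrier x w) : (bterToFree A).map ((freeToBTer A).map P) = P :=
  FreeSig.hom_ext (h := (freeToBTer A).trans (bterToFree A)) (k := BenHom.refl _)
    (fun σ => bterToFree_gen σ) P

/-! ### The bijection between polyderivors and Kleisli morphisms -/

namespace Polyderivor

variable {A B C : Sig.{u}}

theorem toSigHom_onOps (d : Polyderivor A B) {w : List A.sorts} {s : A.sorts} (σ : A.ops w s) :
    Same (FreeSig B).carrier (i := merge (w.map d.onSorts)) (j := d.onSorts s)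
      (d.toSigHom.onOps σ) ((bterToFree B).map (d.onOps σ)) :=
  same_move _ _ rfl _

theorem toSigHom_id (A : Sig.{u}) : (Polyderivor.id A).toSigHom = pdUnit A :=
  ext_pdObj (fun _ => rfl) fun σ => (toSigHom_onOps _ σ).trans <|
    ((bterToFree A).map_same (same_move _ _ rfl _)).trans <|
    (Same.of_eq (bterToFree_gen σ)).trans (pdUnit_onOps σ).symm

/-- Under the canonical homomorphisms, `e♯` is the Kleisli extension of `e`. -/
theorem bterToFree_ap (e : Polyderivor B C) {x w : List B.sorts} (P : (BTer B).carrier x w) :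
    Same (FreeSig C).carrier ((bterToFree C).map (e.ap P))
      ((pdMulHom C).map ((pdSharp e.toSigHom).map ((bterToFree B).map P))) :=
  -- Both sides are homomorphisms out of the term algebra. On σ the left one gives κ(e(σ)); the
  -- right one turns σ into a generator, renames it by the signature morphism of e, and evaluates
  -- that generator, which is again κ(e(σ)).
  (BTer.hom_same (fun _ => (List.append_nil _).symm)
    (e.sharp.trans (pullMap (bterToFree C) e.onSorts))
    ((bterToFree B).trans ((pdSharp e.toSigHom).transPull (pdMulHom C)))
    (fun σ => ((bterToFree C).map_same
        ((Same.of_eq (e.ap_gen σ)).trans (same_move _ _ _ _))).trans <|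
      (e.toSigHom_onOps σ).symm.trans <|
      ((BenHom.transPull_map _ _ _).trans <|
        ((pdMulHom C).map_same_pull
          (((pdSharp e.toSigHom).map_same_pull (.of_eq (bterToFree_gen σ))).trans
            (pdSharp_ofOp _ σ))).trans (pdMulHom_ofOp _)).symm) P).trans <|
  BenHom.transPull_map _ _ _

theorem toSigHom_comp (d : Polyderivor A B) (e : Polyderivor B C) :
    (d.comp e).toSigHom = d.toSigHom ≫ pdMap e.toSigHom ≫ pdMul C := by
  -- Bracketed to the left, the Kleisli composite ends in μ, so its operations unfold from the
  -- outside: first μ, then pd(e), then d.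
  rw [← Category.assoc]
  refine ext_pdObj (fun s => (merge_map_eq _ _).symm) fun {w s} σ => ?_
  refine (toSigHom_onOps _ σ).trans ?_
  refine ((bterToFree C).map_same (same_move _ _ rfl (e.ap (d.onOps σ)))).trans ?_
  refine (bterToFree_ap e _).trans ?_
  refine Same.symm ((comp_pdMul_onOps (d.toSigHom ≫ pdMap e.toSigHom) σ).trans ?_)
  refine (pdMulHom C).map_same_pull ((comp_pdMap_onOps d.toSigHom e.toSigHom σ).trans ?_)
  exact (pdSharp e.toSigHom).map_same_pull (toSigHom_onOps d σ)

/-- The polyderivor that corresponds to a signature morphism `Σ ⟶ pd(Λ)`. -/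
noncomputable def ofSigHom (f : A ⟶ pdObj B) : Polyderivor A B where
  onSorts := f.onSorts
  onOps {w s} σ := (freeToBTer B).map (x := w.flatMap f.onSorts) (w := f.onSorts s)
    (move (FreeSig B).carrier (merge_map_eq f.onSorts w) rfl (f.onOps σ))

theorem toSigHom_ofSigHom (f : A ⟶ pdObj B) : (ofSigHom f).toSigHom = f :=
  ext_pdObj (fun _ => rfl) fun σ => (toSigHom_onOps _ σ).trans <|
    (Same.of_eq (bterToFree_freeToBTer _)).trans (same_move _ _ _ _)

theorem ofSigHom_toSigHom (d : Polyderivor A B) : ofSigHom d.toSigHom = d :=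
  Polyderivor.ext' (fun _ => rfl) fun _ => heq_of_eq <|
    (congrArg (freeToBTer B).map
      (move_move (FreeSig B).carrier (merge_map_eq d.onSorts _).symm rfl _ rfl _)).trans
      (freeToBTer_bterToFree _)

theorem ofSigHom_pdUnit (A : Sig.{u}) : ofSigHom (pdUnit A) = Polyderivor.id A := by
  rw [← toSigHom_id, ofSigHom_toSigHom]

/-- Inverse to a bijection that preserves composition; the equation is obtained by applying
`toSigHom_comp` and cancelling. -/
theorem ofSigHom_comp (f : A ⟶ pdObj B) (g : B ⟶ pdObj C) :
    ofSigHom (f ≫ pdMap g ≫ pdMul C) = (ofSigHom f).comp (ofSigHom g) := by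
  rw [← ofSigHom_toSigHom ((ofSigHom f).comp (ofSigHom g)), toSigHom_comp, toSigHom_ofSigHom,
    toSigHom_ofSigHom]

end Polyderivor

/-! ### The isomorphism of categories -/

/-- The functor from signatures and polyderivors to the Kleisli category. -/
noncomputable def toKleisli : SigPd.{u} ⥤ Kleisli pdMonad.{u} where
  obj A := Kleisli.mk pdMonad A.sig
  map d := Kleisli.Hom.mk (Polyderivor.toSigHom d)
  map_id A := Kleisli.hom_ext (Polyderivor.toSigHom_id A.sig)
  map_comp d e := Kleisli.hom_ext (Polyderivor.toSigHom_comp d e)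

/-- The functor from the Kleisli category to signatures and polyderivors. -/
noncomputable def ofKleisli : Kleisli pdMonad.{u} ⥤ SigPd.{u} where
  obj A := ⟨A.of⟩
  map f := Polyderivor.ofSigHom f.of
  map_id A := Polyderivor.ofSigHom_pdUnit A.of
  map_comp f g := Polyderivor.ofSigHom_comp f.of g.of

/-- Objects agree definitionally, so the `eqToHom` factors in functor extensionality are identities,
and only the bijection on morphisms is left. -/
theorem toKleisli_ofKleisli : toKleisli.{u} ⋙ ofKleisli = 𝟭 SigPd.{u} :=
  CategoryTheory.Functor.ext (fun _ => rfl) fun _ _ d =>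
    (Polyderivor.ofSigHom_toSigHom d).trans
      ((Category.id_comp _).trans (Category.comp_id _)).symm

theorem ofKleisli_toKleisli : ofKleisli.{u} ⋙ toKleisli = 𝟭 (Kleisli pdMonad.{u}) :=
  CategoryTheory.Functor.ext (fun _ => rfl) fun _ _ f =>
    (Kleisli.hom_ext (Polyderivor.toSigHom_ofSigHom f.of)).trans
      ((Category.id_comp _).trans (Category.comp_id _)).symm

end ManySorted

theorem proposition52 :
    ∃ (T : Monad ManySorted.Sig.{u}) (hobj : ∀ A : ManySorted.Sig.{u}, T.obj A = ManySorted.pdObj A),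
      (∀ (A B : ManySorted.Sig.{u}) (d : A ⟶ B),
        T.map d = eqToHom (hobj A) ≫ ManySorted.pdMap d ≫ eqToHom (hobj B).symm) ∧
      (∀ A : ManySorted.Sig.{u}, T.η.app A = ManySorted.pdUnit A ≫ eqToHom (hobj A).symm) ∧
      (∀ A : ManySorted.Sig.{u}, T.μ.app A =
        eqToHom ((hobj (T.obj A)).trans (congrArg ManySorted.pdObj (hobj A))) ≫ ManySorted.pdMul A ≫
          eqToHom (hobj A).symm) ∧
      ∃ (F : ManySorted.SigPd.{u} ⥤ Kleisli T) (G : Kleisli T ⥤ ManySorted.SigPd.{u})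
        (hF : ∀ A : ManySorted.SigPd.{u}, F.obj A = Kleisli.mk T A.sig),
        F ⋙ G = 𝟭 ManySorted.SigPd.{u} ∧ G ⋙ F = 𝟭 (Kleisli T) ∧
        ∀ (A B : ManySorted.SigPd.{u}) (d : ManySorted.Polyderivor A.sig B.sig),
          F.map (X := A) (Y := B) d =
            eqToHom (hF A) ≫ Kleisli.Hom.mk (d.toSigHom ≫ eqToHom (hobj B.sig).symm) ≫
              eqToHom (hF B).symm := by
  -- With the object equalities given by `rfl`, each `eqToHom` is an identity, so the prescribed
  -- data hold by the unit laws of the categories.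
  refine ⟨ManySorted.pdMonad, fun _ => rfl, fun A B d => ?_, fun A => ?_, fun A => ?_,
    ManySorted.toKleisli, ManySorted.ofKleisli, fun _ => rfl, ManySorted.toKleisli_ofKleisli,
    ManySorted.ofKleisli_toKleisli, fun A B d => ?_⟩
  · exact ((Category.id_comp _).trans (Category.comp_id _)).symm
  · exact (Category.comp_id _).symm
  · exact ((Category.id_comp _).trans (Category.comp_id _)).symm
  · refine Eq.symm ((Category.id_comp _).trans ((Category.comp_id _).trans ?_))
    -- The outer identities were those of the Kleisli category; the one remaining lies inside
    -- `Kleisli.Hom.mk` and is removed in `Sig`.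
    exact Kleisli.hom_ext (Category.comp_id _)
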